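/- Let $L\in\mathbb N=\{1,2,\dots\}$, $\ell_0,\ell_1,\ell_2,\ldots\in\mathbb N$, for every $k\in\mathbb N_0$ let $\mathbf d_k=\sum_{n=1}^{k}\ell_n(\ell_{n-1}+1)$, and let $\mathfrak d=\mathbf d_L$. For a function $a\colon\mathbb R\to\mathbb R$, a parameter vector $\theta=(\theta_1,\dots,\theta_{\mathfrak d})\in\mathbb R^{\mathfrak d}$ and $x\in\mathbb R^{\ell_0}$ define $\mathcal N^{k,\theta}_a(x)\in\mathbb R^{\ell_k}$, $k\in\{1,\dots,L\}$, recursively by $$\mathcal N^{k+1,\theta}_{a,i}(x)=\theta_{\ell_{k+1}\ell_k+i+\mathbf d_k}+\sum_{j=1}^{\ell_k}\theta_{(i-1)\ell_k+j+\mathbf d_k}\,z_{k,j},\qquad z_{0,j}=x_j,\qquad z_{k,j}=a\big(\mathcal N^{k,\theta}_{a,j}(x)\big)\ (k\ge 1),$$ for $k\in\{0,\dots,L-1\}$, $i\in\{1,\dots,\ell_{k+1}\}$. Let $S\subseteq\mathbb R$ be finite, let $\mathbf g\colon S\to\mathbb R$, let $\mathfrak g_0\colon\mathbb R\to\mathbb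 R$ satisfy $\mathfrak g_0|_{\mathbb R\setminus S}\in C^1(\mathbb R\setminus S,\mathbb R)$, and define the generalized derivative $\mathscr d\colon\mathbb R\to\mathbb R$ by $\mathscr d(x)=(\mathfrak g_0)'(x)$ for $x\notin S$ and $\mathscr d(x)=\mathbf g(x)$ for $x\in S$. Let $\mathfrak g_n\in C^1(\mathbb R,\mathbb R)$, $n\in\mathbb N$, be such that for every $x\in\mathbb R$ there is $m\in\mathbb N$ with $\sum_{n=m}^\infty\big[|\mathfrak g_n(x)-\mathfrak g_0(x)|+|(\mathfrak g_n)'(x)-\mathscr d(x)|\big]=0$. Let $\mu$ be a finite Borel measure on $\mathbb R^{\ell_0}\times\mathbb R^{\ell_L}$ such that $\{x\in\mathbb R^{\ell_0}\colon \exists\,y\colon (x,y)\in\operatorname{supp}\mu\}$ is bounded, let $H\in C^1(\mathbb R^{\ell_L}\times\mathbb R^{\mathfrak d}\times\mathbb R^{\ell_L},\mathbb R)$, $(u,\theta,y)\mapsto H(u,\theta,y)$, assume for all $n\in\mathbb N_0$, $\theta\in\mathbb R^{\mathfrak d}$ that $\int|H(\mathcal N^{L,\theta}_{\mathfrak g_n}(x),\theta,y)|\,\mu(\mathrm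 dx,\mathrm dy)<\infty$, and let $$\mathcal L_n(\theta)=\int_{\mathbb R^{\ell_0}\times\mathbb R^{\ell_L}}H\big(\mathcal N^{L,\theta}_{\mathfrak g_n}(x),\theta,y\big)\,\mu(\mathrm dx,\mathrm dy).$$ Assume for all $r\in(0,\infty)$, $U\in[-r,r]^{\ell_L}$, $\Theta\in[-r,r]^{\mathfrak d}$ that the quotient $$\frac{\|\nabla_uH(u,\theta,y)\|+\|\nabla_\theta H(u,\theta,y)\|}{1+|H(U,\Theta,y)|}$$ is bounded over all $(x,y)\in\operatorname{supp}\mu$ with $x\in[-r,r]^{\ell_0}$, all $u\in[-r,r]^{\ell_L}$ and all $\theta\in[-r,r]^{\mathfrak d}$. Let $\mathcal G\colon\mathbb R^{\mathfrak d}\to\mathbb R^{\mathfrak d}$ satisfy $\mathcal G(\theta)=\lim_{n\to\infty}(\nabla\mathcal L_n)(\theta)$ for every $\theta\in\mathbb R^{\mathfrak d}$ for which $((\nabla\mathcal L_n)(\theta))_{n\in\mathbb N}$ converges. Assume for all $m\in\mathbb N$ that $\sup_{n\in\mathbb N}\sup_{x\in[-m,m]}\big[|\mathfrak g_n(x)|+|(\mathfrak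 g_n)'(x)|\big]<\infty$, and assume that $$\min_{z\in\{-1,1\}}\ \sum_{x\in S}\ \limsup_{h\searrow0}\,|\mathscr d(x+zh)-\mathscr d(x)|=0.$$ For $f\in C(\mathbb R^{\mathfrak d},\mathbb R)$ and $x\in\mathbb R^{\mathfrak d}$ let $$(\mathcal Df)(x)=\Big\{y\in\mathbb R^{\mathfrak d}\colon\liminf_{0\ne h\to0}\frac{f(x+h)-f(x)-\langle y,h\rangle}{\|h\|}\ge0\Big\},\qquad (\mathbb Df)(x)=\bigcap_{\varepsilon>0}\overline{\bigcup_{\|y-x\|<\varepsilon}(\mathcal Df)(y)}$$ denote the sets of Fréchet subgradients and of limiting Fréchet subgradients of $f$ at $x$. Then for every $\theta\in\mathbb R^{\mathfrak d}$ it holds that $\mathcal G(\theta)\in(\mathbb D\mathcal L_0)(\theta)$. -/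

import Mathlib

open Filter Topology MeasureTheory
open scoped ENNReal Gradient

noncomputable section

namespace DeepANN

/-- The function `𝒹_g f`: it is `f'` off `A` and `g` on `A`. -/
def genDeriv (A : Set ℝ) (g : A → ℝ) (f : ℝ → ℝ) (x : ℝ) : ℝ :=
  open Classical in if h : x ∈ A then g ⟨x, h⟩ else deriv f x

/-- The number `∑_{n=1}^k ℓ_n (ℓ_{n-1} + 1)` of parameters of the first `k` layers of the
architecture `ℓ`. -/
def numParams (ℓ : ℕ → ℕ) (k : ℕ) : ℕ :=
  ∑ n ∈ Finset.Icc 1 k, ℓ n * (ℓ (n - 1) + 1)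

/-- The parameter vectors of networks with `L` affine layers. -/
abbrev Param (ℓ : ℕ → ℕ) (L : ℕ) : Type := EuclideanSpace ℝ (Fin (numParams ℓ L))

/-- Coordinate number `m` (counted from `0`) of the parameter vector. It is extended by `0` past
the end of the vector, which is never reached in the layers `1, …, L`; see `weight_index_lt` and
`bias_index_lt`. -/
def coord {ℓ : ℕ → ℕ} {L : ℕ} (θ : Param ℓ L) (m : ℕ) : ℝ :=
  if h : m < numParams ℓ L then θ ⟨m, h⟩ else 0

/-- The weight from neuron `j` of layer `k` to neuron `i` of layer `k + 1`
(neurons counted from `0`). -/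
def weight {ℓ : ℕ → ℕ} {L : ℕ} (θ : Param ℓ L) (k : ℕ) (i : Fin (ℓ (k + 1))) (j : Fin (ℓ k)) : ℝ :=
  coord θ (i * ℓ k + j + numParams ℓ k)

/-- The bias of neuron `i` of layer `k + 1` (neurons counted from `0`). -/
def bias {ℓ : ℕ → ℕ} {L : ℕ} (θ : Param ℓ L) (k : ℕ) (i : Fin (ℓ (k + 1))) : ℝ :=
  coord θ (ℓ (k + 1) * ℓ k + i + numParams ℓ k)

theorem numParams_succ (ℓ : ℕ → ℕ) (k : ℕ) :
    numParams ℓ (k + 1) = numParams ℓ k + ℓ (k + 1) * (ℓ k + 1) := by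
  simp [numParams, Finset.sum_Icc_succ_top]

theorem numParams_mono (ℓ : ℕ → ℕ) : Monotone (numParams ℓ) :=
  monotone_nat_of_le_succ fun k => by rw [numParams_succ]; exact Nat.le_add_right _ _

theorem bias_index_lt {ℓ : ℕ → ℕ} {L k : ℕ} (hk : k < L) (i : Fin (ℓ (k + 1))) :
    ℓ (k + 1) * ℓ k + i + numParams ℓ k < numParams ℓ L := by
  have h := numParams_mono ℓ (Nat.succ_le_of_lt hk)
  rw [Nat.succ_eq_add_one, numParams_succ] at h
  have := i.isLt
  nlinarith

theorem weight_index_lt {ℓ : ℕ → ℕ} {L k : ℕ} (hk : k < L) (i : Fin (ℓ (k + 1)))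
    (j : Fin (ℓ k)) : i * ℓ k + j + numParams ℓ k < numParams ℓ L := by
  have h := numParams_mono ℓ (Nat.succ_le_of_lt hk)
  rw [Nat.succ_eq_add_one, numParams_succ] at h
  have hi := i.isLt
  have hj := j.isLt
  have : ((i : ℕ) + 1) * ℓ k ≤ ℓ (k + 1) * ℓ k := Nat.mul_le_mul_right _ hi
  nlinarith

/-- The affine map from layer `k` to layer `k + 1`. -/
def affineLayer {ℓ : ℕ → ℕ} {L : ℕ} (θ : Param ℓ L) (k : ℕ) (v : EuclideanSpace ℝ (Fin (ℓ k))) :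
    EuclideanSpace ℝ (Fin (ℓ (k + 1))) :=
  WithLp.toLp 2 fun i => bias θ k i + ∑ j, weight θ k i j * v j

/-- The realization `𝒩^{k,θ}(x)` of the first `k` layers with activation function `a`. The
activation is applied between consecutive affine maps, neither to the input nor after the last
affine map. -/
def realization {ℓ : ℕ → ℕ} {L : ℕ} (a : ℝ → ℝ) (θ : Param ℓ L)
    (x : EuclideanSpace ℝ (Fin (ℓ 0))) : (k : ℕ) → EuclideanSpace ℝ (Fin (ℓ k))
  | 0 => x
  | 1 => affineLayer θ 0 x
  | k + 2 => affineLayer θ (k + 1)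
      (WithLp.toLp 2 fun j => a (realization a θ x (k + 1) j))

/-- The risk `ℒ(θ) = ∫ H(𝒩^{L,θ}(x), θ, y) μ(dx, dy)` for the activation function `a`. -/
def risk {ℓ : ℕ → ℕ} {L : ℕ}
    (μ : Measure (EuclideanSpace ℝ (Fin (ℓ 0)) × EuclideanSpace ℝ (Fin (ℓ L))))
    (H : EuclideanSpace ℝ (Fin (ℓ L)) × Param ℓ L × EuclideanSpace ℝ (Fin (ℓ L)) → ℝ)
    (a : ℝ → ℝ) (θ : Param ℓ L) : ℝ :=
  ∫ p, H (realization a θ p.1 L, θ, p.2) ∂μ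

/-- `∑_{x ∈ S} limsup_{h ↘ 0} |f(x + z h) - f(x)|`, with values in `[0, ∞]`. -/
def oneSidedJump (S : Finset ℝ) (f : ℝ → ℝ) (z : ℝ) : ℝ≥0∞ :=
  ∑ x ∈ S, limsup (fun h : ℝ => ENNReal.ofReal |f (x + z * h) - f x|) (𝓝[>] 0)

/-- The set `(𝒟 f)(x)` of Fréchet subgradients. -/
def frechetSubdiff {n : ℕ} (f : EuclideanSpace ℝ (Fin n) → ℝ) (x : EuclideanSpace ℝ (Fin n)) :
    Set (EuclideanSpace ℝ (Fin n)) :=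
  {y | 0 ≤ liminf (fun h : EuclideanSpace ℝ (Fin n) =>
    (((f (x + h) - f x - inner ℝ y h) / ‖h‖ : ℝ) : EReal)) (𝓝[≠] 0)}

/-- The limiting Fréchet subdifferential `(𝔻 f)(x)`. -/
def limitingSubdiff {n : ℕ} (f : EuclideanSpace ℝ (Fin n) → ℝ) (x : EuclideanSpace ℝ (Fin n)) :
    Set (EuclideanSpace ℝ (Fin n)) :=
  ⋂ ε ∈ Set.Ioi (0 : ℝ), closure (⋃ y ∈ Metric.ball x ε, frechetSubdiff f y)

end DeepANN

end

/-!
Since the approximating activations and their derivatives eventually agree pointwise with the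
activation and its generalized derivative, dominated convergence shows that the gradients of the
approximating risks at `θ` converge to the integral of the formal chain-rule derivatives of the
loss. Let `z` be the side on which the generalized derivative is continuous at every kink, and let
`v` shift the biases in direction `z`, with speeds growing so fast from layer to layer that for
small `t ≥ 0` every preactivation of the network with parameters `θ + t • v` moves strictly
monotonically to the side `z`. Each kink is then the value of a given preactivation on a set of
positive measure for at most countably many `t`. Hence for arbitrarily small `t > 0` the risk is
differentiable at `θ + t • v`, its gradient being the integral of the formal derivatives, and by
one-sided continuity these integrals converge, as `t ↘ 0`, to the one at `θ`.
-/

noncomputable section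

namespace DeepANN

section Calculus

theorem lipschitzOnWith_of_eventually_eq {ι α β : Type*} [PseudoEMetricSpace α]
    [PseudoEMetricSpace β] {l : Filter ι} [l.NeBot] {C : NNReal} {s : Set α} {f : ι → α → β}
    {g : α → β} (hf : ∀ n, LipschitzOnWith C (f n) s) (h : ∀ x ∈ s, ∀ᶠ n in l, f n x = g x) :
    LipschitzOnWith C g s := by
  intro x hx y hy
  obtain ⟨n, hnx, hny⟩ := ((h x hx).and (h y hy)).exists
  simpa only [hnx, hny] using hf n hx hy

theorem exists_norm_le_of_continuous {E F : Type*} [SeminormedAddCommGroup E] [ProperSpace E]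
    [SeminormedAddCommGroup F] {f : E → F} (hf : Continuous f) (R : ℝ) :
    ∃ C, ∀ x, ‖x‖ ≤ R → ‖f x‖ ≤ C := by
  obtain ⟨C, hC⟩ := (isCompact_closedBall (0 : E) R).exists_bound_of_continuousOn hf.continuousOn
  exact ⟨C, fun x hx => hC x (mem_closedBall_zero_iff.2 hx)⟩

theorem continuous_clm_prod {E F G : Type*} [NormedAddCommGroup E] [NormedSpace ℝ E]
    [NormedAddCommGroup F] [NormedSpace ℝ F] [NormedAddCommGroup G] [NormedSpace ℝ G] :
    Continuous fun q : (E →L[ℝ] F) × (E →L[ℝ] G) => q.1.prod q.2 :=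
  (ContinuousLinearMap.prodₗᵢ ℝ).continuous

theorem norm_fderiv_comp_prod_le {E F G : Type*} [NormedAddCommGroup E] [InnerProductSpace ℝ E]
    [CompleteSpace E] [NormedAddCommGroup F] [InnerProductSpace ℝ F] [CompleteSpace F]
    [NormedAddCommGroup G] [NormedSpace ℝ G] {H : E × F × G → ℝ} {u : E} {θ : F} {y : G}
    (hH : DifferentiableAt ℝ H (u, θ, y)) (D : F →L[ℝ] E) :
    ‖fderiv ℝ H (u, θ, y) ∘L D.prod ((ContinuousLinearMap.id ℝ F).prod 0)‖ ≤
      (1 + ‖D‖) * (‖∇ (fun u' => H (u', θ, y)) u‖ + ‖∇ (fun θ' => H (u, θ', y)) θ‖) := by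
  have hu : HasFDerivAt (fun u' => H (u', θ, y)) _ u :=
    hH.hasFDerivAt.comp (f := fun u' => (u', θ, y)) u
      ((hasFDerivAt_id u).prodMk (hasFDerivAt_const (θ, y) u))
  have hθ : HasFDerivAt (fun θ' => H (u, θ', y)) _ θ :=
    hH.hasFDerivAt.comp (f := fun θ' => (u, θ', y)) θ
      ((hasFDerivAt_const u θ).prodMk ((hasFDerivAt_id θ).prodMk (hasFDerivAt_const y θ)))
  have split : fderiv ℝ H (u, θ, y) ∘L D.prod ((ContinuousLinearMap.id ℝ F).prod 0) =
      fderiv ℝ (fun u' => H (u', θ, y)) u ∘L D + fderiv ℝ (fun θ' => H (u, θ', y)) θ := by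
    rw [hu.fderiv, hθ.fderiv]
    ext w
    simp [← map_add]
  rw [split, ← toDual_gradient, ← toDual_gradient]
  refine (norm_add_le _ _).trans
    ((add_le_add_left (ContinuousLinearMap.opNorm_comp_le _ _) _).trans ?_)
  simp only [LinearIsometryEquiv.norm_map]
  nlinarith [norm_nonneg (∇ (fun u' => H (u', θ, y)) u), norm_nonneg D,
    norm_nonneg (∇ (fun θ' => H (u, θ', y)) θ)]

end Calculus

section Subdifferential

variable {n : ℕ} {f : EuclideanSpace ℝ (Fin n) → ℝ}

theorem mem_frechetSubdiff_of_hasGradientAt {x y : EuclideanSpace ℝ (Fin n)}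
    (h : HasGradientAt f y x) : y ∈ frechetSubdiff f x := by
  have hlim : Tendsto (fun h => (f (x + h) - f x - inner ℝ y h) / ‖h‖) (𝓝[≠] 0) (𝓝 0) :=
    ((hasGradientAt_iff_isLittleO_nhds_zero.1 h).norm_right.tendsto_div_nhds_zero).mono_left
      nhdsWithin_le_nhds
  change (0 : EReal) ≤ liminf _ _
  rcases (𝓝[≠] (0 : EuclideanSpace ℝ (Fin n))).eq_or_neBot with hbot | _
  · rw [hbot, liminf_bot]
    exact le_top
  · exact ((continuous_coe_real_ereal.tendsto 0).comp hlim).liminf_eq.ge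

theorem mem_limitingSubdiff_of_frequently {ι : Type*} {l : Filter ι}
    {x w : ι → EuclideanSpace ℝ (Fin n)} {x₀ w₀ : EuclideanSpace ℝ (Fin n)}
    (hx : Tendsto x l (𝓝 x₀)) (hw : Tendsto w l (𝓝 w₀))
    (h : ∃ᶠ t in l, w t ∈ frechetSubdiff f (x t)) : w₀ ∈ limitingSubdiff f x₀ := by
  refine Set.mem_iInter₂.2 fun ε hε => mem_closure_of_frequently_of_tendsto ?_ hw
  exact (h.and_eventually (hx (Metric.ball_mem_nhds x₀ hε))).mono fun t ht =>
    Set.mem_biUnion ht.2 ht.1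

end Subdifferential

section Kinks

theorem countable_setOf_measure_pos_of_ae_injOn {T X Y : Type*} [MeasurableSpace X]
    [MeasurableSpace Y] [MeasurableSingletonClass Y] {μ : Measure X} [SFinite μ]
    {N : T → X → Y} {I : Set T} (hN : ∀ t, Measurable (N t))
    (hinj : ∀ᵐ x ∂μ, I.InjOn fun t => N t x) (y : Y) :
    {t ∈ I | 0 < μ (N t ⁻¹' {y})}.Countable := by
  have hcount : {t : I | 0 < μ (N t ⁻¹' {y})}.Countable := by
    refine Measure.countable_meas_pos_of_disjoint_iUnion₀
      (fun t => (hN t (measurableSet_singleton y)).nullMeasurableSet) fun t t' htt' => ?_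
    refine measure_mono_null (t := {x | ¬ I.InjOn fun t => N t x}) (fun x hx hxinj => ?_)
      (ae_iff.1 hinj)
    exact htt' (Subtype.ext (hxinj t.2 t'.2 (hx.1.trans hx.2.symm)))
  refine (hcount.image Subtype.val).mono ?_
  rintro t ⟨htI, ht⟩
  exact ⟨⟨t, htI⟩, ht, rfl⟩

theorem countable_setOf_not_ae_notMem {T X Y : Type*} [MeasurableSpace X]
    [MeasurableSpace Y] [MeasurableSingletonClass Y] {μ : Measure X} [SFinite μ]
    {N : T → X → Y} {I : Set T} (hN : ∀ t, Measurable (N t))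
    (hinj : ∀ᵐ x ∂μ, I.InjOn fun t => N t x) {S : Set Y} (hS : S.Countable) :
    {t ∈ I | ¬ ∀ᵐ x ∂μ, N t x ∉ S}.Countable := by
  refine (hS.biUnion fun s _ => countable_setOf_measure_pos_of_ae_injOn hN hinj s).mono ?_
  rintro t ⟨htI, ht⟩
  contrapose! ht
  have hnull : ∀ s ∈ S, ∀ᵐ x ∂μ, N t x ≠ s := fun s hs =>
    measure_eq_zero_iff_ae_notMem.1 <| le_zero_iff.1 <| not_lt.1 fun hpos =>
      ht (Set.mem_biUnion hs ⟨htI, hpos⟩)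
  filter_upwards [(ae_ball_iff hS).2 hnull] with x hx hxS using hx _ hxS rfl

theorem frequently_nhdsGT_notMem_of_countable {s : Set ℝ} (hs : s.Countable) (x : ℝ) :
    ∃ᶠ t in 𝓝[>] x, t ∉ s := by
  rw [frequently_iff]
  intro U hU
  obtain ⟨y, hxy, hyU⟩ := mem_nhdsGT_iff_exists_Ioo_subset.1 hU
  obtain ⟨t, ht, hts⟩ := (hs.dense_compl ℝ).inter_open_nonempty _ isOpen_Ioo
    (Set.nonempty_Ioo.2 hxy)
  exact ⟨t, hyU ht, hts⟩

theorem tendsto_comp_of_tendsto_oneSided {ι : Type*} {l : Filter ι} {f : ℝ → ℝ} {z s : ℝ}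
    (hz : z ≠ 0) (hf : Tendsto (fun h => f (s + z * h)) (𝓝[>] 0) (𝓝 (f s))) {N : ι → ℝ}
    (hN : Tendsto N l (𝓝 s)) (hlt : ∀ᶠ t in l, z * s < z * N t) :
    Tendsto (fun t => f (N t)) l (𝓝 (f s)) := by
  have hstep : Tendsto (fun t => (N t - s) / z) l (𝓝[>] 0) := by
    refine tendsto_nhdsWithin_iff.2 ⟨by simpa using (hN.sub_const s).div_const z, ?_⟩
    filter_upwards [hlt] with t ht
    have hpos : 0 < z * (N t - s) / z ^ 2 := div_pos (by linarith) (by positivity)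
    rwa [pow_two, mul_div_mul_left _ _ hz] at hpos
  refine (hf.comp hstep).congr fun t => ?_
  rw [Function.comp_apply, mul_div_cancel₀ _ hz, add_sub_cancel]

end Kinks

section Networks

variable {ℓ : ℕ → ℕ} {L : ℕ}

theorem coord_add (θ θ' : Param ℓ L) (m : ℕ) : coord (θ + θ') m = coord θ m + coord θ' m := by
  unfold coord
  split_ifs <;> simp

theorem coord_smul (c : ℝ) (θ : Param ℓ L) (m : ℕ) : coord (c • θ) m = c * coord θ m := by
  unfold coord
  split_ifs <;> simp

theorem abs_coord_le (θ : Param ℓ L) (m : ℕ) : |coord θ m| ≤ ‖θ‖ := by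
  unfold coord
  split_ifs
  · exact PiLp.norm_apply_le θ _
  · simp

theorem contDiff_coord (m : ℕ) : ContDiff ℝ 1 fun θ : Param ℓ L => coord θ m := by
  unfold coord
  split_ifs <;> fun_prop

theorem contDiff_affineLayer (k : ℕ) :
    ContDiff ℝ 1 fun q : Param ℓ L × EuclideanSpace ℝ (Fin (ℓ k)) => affineLayer q.1 k q.2 := by
  have hcoord (m : ℕ) : ContDiff ℝ 1 fun q : Param ℓ L × EuclideanSpace ℝ (Fin (ℓ k)) =>
      coord q.1 m := (contDiff_coord m).comp contDiff_fst
  refine contDiff_euclidean.2 fun i => (hcoord _).add (ContDiff.sum fun j _ => (hcoord _).mul ?_)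
  fun_prop

/-- The activation function `a` applied coordinatewise. -/
def activate {n : ℕ} (a : ℝ → ℝ) (v : EuclideanSpace ℝ (Fin n)) : EuclideanSpace ℝ (Fin n) :=
  WithLp.toLp 2 fun j => a (v j)

/-- Coordinatewise multiplication by `v`: the derivative of `activate a` is multiplication by the
coordinatewise derivatives of `a`. -/
def scaleCoords {n : ℕ} (v : EuclideanSpace ℝ (Fin n)) :
    EuclideanSpace ℝ (Fin n) →L[ℝ] EuclideanSpace ℝ (Fin n) :=
  Matrix.toEuclideanCLM (𝕜 := ℝ) (Matrix.diagonal v)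

theorem scaleCoords_apply {n : ℕ} (v w : EuclideanSpace ℝ (Fin n)) :
    scaleCoords v w = WithLp.toLp 2 fun j => v j * w j := by
  ext j
  simp [scaleCoords, Matrix.mulVec_diagonal]

theorem continuous_scaleCoords {n : ℕ} : Continuous (scaleCoords (n := n)) := by
  refine continuous_clm_apply.2 fun w => ?_
  simp_rw [scaleCoords_apply]
  fun_prop

theorem hasFDerivAt_activate {n : ℕ} {a b : ℝ → ℝ} {v : EuclideanSpace ℝ (Fin n)}
    (h : ∀ j, HasDerivAt a (b (v j)) (v j)) :
    HasFDerivAt (activate a) (scaleCoords (activate b v)) v := by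
  refine hasFDerivWithinAt_univ.1 <| hasFDerivWithinAt_euclidean.2 fun j => ?_
  have hderiv : EuclideanSpace.proj j ∘L scaleCoords (activate b v) =
      b (v j) • EuclideanSpace.proj (𝕜 := ℝ) j := by
    ext w
    simp only [ContinuousLinearMap.comp_apply, scaleCoords_apply]
    rfl
  exact hderiv ▸ ((h j).comp_hasFDerivAt v
    (EuclideanSpace.proj (𝕜 := ℝ) j).hasFDerivAt).hasFDerivWithinAt

theorem tendsto_activate {ι : Type*} {l : Filter ι} {n : ℕ} {a : ℝ → ℝ}
    {v : ι → EuclideanSpace ℝ (Fin n)} {w : EuclideanSpace ℝ (Fin n)}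
    (h : ∀ j, Tendsto (fun t => a (v t j)) l (𝓝 (a (w j)))) :
    Tendsto (fun t => activate a (v t)) l (𝓝 (activate a w)) :=
  ((PiLp.continuous_toLp 2 _).tendsto _).comp (tendsto_pi_nhds.2 h)

theorem exists_norm_activate_le {ι : Type*} {f : ι → ℝ → ℝ} {K C : ℝ}
    (hf : ∀ i x, ‖x‖ ≤ K → ‖f i x‖ ≤ C) (n : ℕ) :
    ∃ C', ∀ i (v : EuclideanSpace ℝ (Fin n)), ‖v‖ ≤ K → ‖activate (f i) v‖ ≤ C' := by
  obtain ⟨C', hC'⟩ := exists_norm_le_of_continuous (PiLp.continuous_toLp 2 fun _ : Fin n => ℝ) |C|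
  exact ⟨C', fun i v hv => hC' _ <| (pi_norm_le_iff_of_nonneg (abs_nonneg C)).2 fun j =>
    (hf i _ ((PiLp.norm_apply_le v j).trans hv)).trans (le_abs_self C)⟩

/-- The derivative of `affineLayer θ k v` with respect to the parameters `θ` when `v` depends on
them with derivative `D`. -/
def affineDeriv (θ : Param ℓ L) (k : ℕ) (v : EuclideanSpace ℝ (Fin (ℓ k)))
    (D : Param ℓ L →L[ℝ] EuclideanSpace ℝ (Fin (ℓ k))) :
    Param ℓ L →L[ℝ] EuclideanSpace ℝ (Fin (ℓ (k + 1))) :=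
  fderiv ℝ (fun q : Param ℓ L × EuclideanSpace ℝ (Fin (ℓ k)) => affineLayer q.1 k q.2) (θ, v) ∘L
    (ContinuousLinearMap.id ℝ _).prod D

theorem hasFDerivAt_affineLayer {θ : Param ℓ L} {k : ℕ}
    {v : Param ℓ L → EuclideanSpace ℝ (Fin (ℓ k))}
    {D : Param ℓ L →L[ℝ] EuclideanSpace ℝ (Fin (ℓ k))} (h : HasFDerivAt v D θ) :
    HasFDerivAt (fun θ' => affineLayer θ' k (v θ')) (affineDeriv θ k (v θ) D) θ :=
  ((contDiff_affineLayer k).differentiable one_ne_zero (θ, v θ)).hasFDerivAt.comp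
    (f := fun θ' => (θ', v θ')) θ ((hasFDerivAt_id θ).prodMk h)

theorem continuous_affineDeriv (k : ℕ) :
    Continuous fun q : Param ℓ L × EuclideanSpace ℝ (Fin (ℓ k)) ×
      (Param ℓ L →L[ℝ] EuclideanSpace ℝ (Fin (ℓ k))) => affineDeriv q.1 k q.2.1 q.2.2 :=
  (((contDiff_affineLayer k).continuous_fderiv one_ne_zero).comp
    (continuous_fst.prodMk continuous_snd.fst)).clm_comp
    (continuous_clm_prod.comp (continuous_const.prodMk continuous_snd.snd))

/-- The formal derivative of `realization a θ x k` with respect to the parameters `θ`, where `b`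
takes the place of the derivative of `a`. -/
def realizationDeriv (a b : ℝ → ℝ) (θ : Param ℓ L) (x : EuclideanSpace ℝ (Fin (ℓ 0))) :
    (k : ℕ) → Param ℓ L →L[ℝ] EuclideanSpace ℝ (Fin (ℓ k))
  | 0 => 0
  | 1 => affineDeriv θ 0 x 0
  | k + 2 => affineDeriv θ (k + 1) (activate a (realization a θ x (k + 1)))
      (scaleCoords (activate b (realization a θ x (k + 1))) ∘L realizationDeriv a b θ x (k + 1))

variable {a b : ℝ → ℝ}

theorem hasFDerivAt_realization {θ : Param ℓ L} {x : EuclideanSpace ℝ (Fin (ℓ 0))} :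
    ∀ {k : ℕ}, (∀ m ∈ Set.Ioo 0 k, ∀ i, HasDerivAt a (b (realization a θ x m i))
      (realization a θ x m i)) →
    HasFDerivAt (fun θ' => realization a θ' x k) (realizationDeriv a b θ x k) θ
  | 0, _ => hasFDerivAt_const x θ
  | 1, _ => hasFDerivAt_affineLayer (hasFDerivAt_const x θ)
  | k + 2, h => hasFDerivAt_affineLayer <|
      (hasFDerivAt_activate (h (k + 1) ⟨by omega, by omega⟩)).comp θ
        (hasFDerivAt_realization fun m hm => h m ⟨hm.1, by grind⟩)

theorem continuous_realization (ha : Continuous a) :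
    ∀ k, Continuous fun q : Param ℓ L × EuclideanSpace ℝ (Fin (ℓ 0)) => realization a q.1 q.2 k
  | 0 => continuous_snd
  | 1 => (contDiff_affineLayer 0).continuous
  | k + 2 => (contDiff_affineLayer (k + 1)).continuous.comp <| continuous_fst.prodMk <|
      continuous_iff_continuousAt.2 fun _ => tendsto_activate fun j =>
        (ha.comp ((PiLp.continuous_apply 2 _ j).comp (continuous_realization ha (k + 1)))).tendsto _

theorem tendsto_realizationDeriv {ι : Type*} {l : Filter ι} (ha : Continuous a)
    {θ : ι → Param ℓ L} {θ₀ : Param ℓ L} {x : ι → EuclideanSpace ℝ (Fin (ℓ 0))}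
    {x₀ : EuclideanSpace ℝ (Fin (ℓ 0))} (hθ : Tendsto θ l (𝓝 θ₀)) (hx : Tendsto x l (𝓝 x₀)) :
    ∀ {k : ℕ}, (∀ m ∈ Set.Ioo 0 k, ∀ i, Tendsto (fun t => b (realization a (θ t) (x t) m i)) l
      (𝓝 (b (realization a θ₀ x₀ m i)))) →
    Tendsto (fun t => realizationDeriv a b (θ t) (x t) k) l (𝓝 (realizationDeriv a b θ₀ x₀ k))
  | 0, _ => tendsto_const_nhds
  | 1, _ => ((continuous_affineDeriv 0).tendsto (θ₀, x₀, 0)).comp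
      (hθ.prodMk_nhds (hx.prodMk_nhds tendsto_const_nhds))
  | k + 2, hb => by
    have hact : Tendsto (fun t => activate a (realization a (θ t) (x t) (k + 1))) l
        (𝓝 (activate a (realization a θ₀ x₀ (k + 1)))) := by
      refine tendsto_activate fun j => (ha.tendsto _).comp ?_
      exact (((PiLp.continuous_apply 2 _ j).comp (continuous_realization ha (k + 1))).tendsto
        (θ₀, x₀)).comp (hθ.prodMk_nhds hx)
    have hscale := (continuous_scaleCoords.tendsto _).comp
      (tendsto_activate (hb (k + 1) ⟨by omega, by omega⟩))
    have hderiv := tendsto_realizationDeriv ha hθ hx (k := k + 1) fun m hm =>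
      hb m ⟨hm.1, by grind⟩
    have hcomp := ((continuous_fst.clm_comp continuous_snd).tendsto (_, _)).comp
      (hscale.prodMk_nhds hderiv)
    exact ((continuous_affineDeriv (k + 1)).tendsto (θ₀, _, _)).comp
      (hθ.prodMk_nhds (hact.prodMk_nhds hcomp))

theorem realization_congr {a' : ℝ → ℝ} {θ : Param ℓ L} {x : EuclideanSpace ℝ (Fin (ℓ 0))} :
    ∀ {k : ℕ}, (∀ m ∈ Set.Ioo 0 k, ∀ i, a' (realization a θ x m i) = a (realization a θ x m i)) →
    realization a' θ x k = realization a θ x k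
  | 0, _ => rfl
  | 1, _ => rfl
  | k + 2, h => by
    have hact := funext (h (k + 1) ⟨by omega, by omega⟩)
    rw [realization, realization, realization_congr fun m hm => h m ⟨hm.1, by grind⟩, hact]

theorem realizationDeriv_congr {a' b' : ℝ → ℝ} {θ : Param ℓ L} {x : EuclideanSpace ℝ (Fin (ℓ 0))} :
    ∀ {k : ℕ}, (∀ m ∈ Set.Ioo 0 k, ∀ i, a' (realization a θ x m i) = a (realization a θ x m i) ∧
      b' (realization a θ x m i) = b (realization a θ x m i)) →
    realizationDeriv a' b' θ x k = realizationDeriv a b θ x k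
  | 0, _ => rfl
  | 1, _ => rfl
  | k + 2, h => by
    have hlower : ∀ m ∈ Set.Ioo 0 (k + 1), _ := fun m hm => h m ⟨hm.1, by grind⟩
    have hact := h (k + 1) ⟨by omega, by omega⟩
    rw [realizationDeriv, realizationDeriv, realizationDeriv_congr hlower,
      realization_congr fun m hm i => (hlower m hm i).1, activate, activate, activate, activate,
      funext fun i => (hact i).1, funext fun i => (hact i).2]

theorem realization_zero_param (a : ℝ → ℝ) (x : EuclideanSpace ℝ (Fin (ℓ 0))) :
    ∀ {k : ℕ}, k ≠ 0 → realization a (0 : Param ℓ L) x k = 0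
  | 1, _ | k + 2, _ => by ext i; simp [realization, affineLayer, bias, weight, coord]

theorem exists_norm_realization_le {ι : Type*} {f : ι → ℝ → ℝ}
    (hf : ∀ R, ∃ C, ∀ n x, ‖x‖ ≤ R → ‖f n x‖ ≤ C) (R : ℝ) :
    ∀ k, ∃ C, ∀ n (θ : Param ℓ L) x, ‖θ‖ ≤ R → ‖x‖ ≤ R → ‖realization (f n) θ x k‖ ≤ C
  | 0 => ⟨R, fun _ _ _ _ hx => hx⟩
  | 1 => by
    obtain ⟨C, hC⟩ := exists_norm_le_of_continuous (contDiff_affineLayer (L := L) 0).continuous R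
    exact ⟨C, fun _ θ x hθ hx => hC (θ, x) (norm_prod_le_iff.2 ⟨hθ, hx⟩)⟩
  | k + 2 => by
    obtain ⟨K, hK⟩ := exists_norm_realization_le hf R (k + 1)
    obtain ⟨K', hK'⟩ := hf K
    obtain ⟨A, hA⟩ := exists_norm_activate_le hK' (ℓ (k + 1))
    obtain ⟨C, hC⟩ := exists_norm_le_of_continuous
      (contDiff_affineLayer (L := L) (k + 1)).continuous (max R A)
    exact ⟨C, fun n θ x hθ hx => hC (θ, _) <| norm_prod_le_iff.2
      ⟨le_max_of_le_left hθ, le_max_of_le_right (hA n _ (hK n θ x hθ hx))⟩⟩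

theorem exists_norm_realizationDeriv_le {ι : Type*} {f f' : ι → ℝ → ℝ}
    (hf : ∀ R, ∃ C, ∀ n x, ‖x‖ ≤ R → ‖f n x‖ ≤ C ∧ ‖f' n x‖ ≤ C) (R : ℝ) :
    ∀ k, ∃ C, ∀ n (θ : Param ℓ L) x, ‖θ‖ ≤ R → ‖x‖ ≤ R →
      ‖realizationDeriv (f n) (f' n) θ x k‖ ≤ C
  | 0 => ⟨0, fun _ _ _ _ _ => norm_zero.le⟩
  | 1 => by
    obtain ⟨C, hC⟩ := exists_norm_le_of_continuous (continuous_affineDeriv (ℓ := ℓ) (L := L) 0) R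
    exact ⟨C, fun _ θ x hθ hx => hC (θ, x, 0) (by simp [hθ, hx])⟩
  | k + 2 => by
    obtain ⟨K, hK⟩ := exists_norm_realization_le (fun R => (hf R).imp fun C hC n x hx =>
      (hC n x hx).1) R (k + 1)
    obtain ⟨K', hK'⟩ := exists_norm_realizationDeriv_le hf R (k + 1)
    obtain ⟨K₁, hK₁⟩ := hf K
    obtain ⟨A, hA⟩ := exists_norm_activate_le (fun n x hx => (hK₁ n x hx).1) (ℓ (k + 1))
    obtain ⟨A', hA'⟩ := exists_norm_activate_le (fun n x hx => (hK₁ n x hx).2) (ℓ (k + 1))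
    obtain ⟨B, hB⟩ := exists_norm_le_of_continuous (continuous_scaleCoords (n := ℓ (k + 1))) A'
    obtain ⟨C, hC⟩ := exists_norm_le_of_continuous
      (continuous_affineDeriv (ℓ := ℓ) (L := L) (k + 1)) (max R (max A (B * K')))
    refine ⟨C, fun n θ x hθ hx => hC (θ, _, _) ?_⟩
    have hv := hK n θ x hθ hx
    have hs := hB _ (hA' n _ hv)
    simp only [norm_prod_le_iff]
    refine ⟨le_max_of_le_left hθ, le_max_of_le_right (le_max_of_le_left (hA n _ hv)),
      le_max_of_le_right (le_max_of_le_right ?_)⟩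
    exact (ContinuousLinearMap.opNorm_comp_le _ _).trans
      (mul_le_mul hs (hK' n θ x hθ hx) (norm_nonneg _) ((norm_nonneg _).trans hs))

end Networks

section Approximations

/-- Continuously differentiable approximations `f n` of an activation function `a` and of a
generalized derivative `b` of `a`: at every point the values and the derivatives of `f n`
eventually equal those of `a` and `b`, and both are uniformly bounded on bounded sets. -/
structure IsC1Approx (f : ℕ → ℝ → ℝ) (a b : ℝ → ℝ) : Prop where
  contDiff : ∀ n, ContDiff ℝ 1 (f n)
  eventually_eq : ∀ x, ∀ᶠ n in atTop, f n x = a x ∧ deriv (f n) x = b x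
  bounded : ∀ R, ∃ C, ∀ n x, ‖x‖ ≤ R → ‖f n x‖ ≤ C ∧ ‖deriv (f n) x‖ ≤ C

theorem IsC1Approx.const {f : ℝ → ℝ} (hf : ContDiff ℝ 1 f) :
    IsC1Approx (fun _ => f) f (deriv f) where
  contDiff _ := hf
  eventually_eq _ := Eventually.of_forall fun _ => ⟨rfl, rfl⟩
  bounded R := by
    obtain ⟨C, hC⟩ := exists_norm_le_of_continuous
      (hf.continuous.prodMk (hf.continuous_deriv le_rfl)) R
    exact ⟨C, fun _ x hx => norm_prod_le_iff.1 (hC x hx)⟩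

variable {f : ℕ → ℝ → ℝ} {a b : ℝ → ℝ}

theorem IsC1Approx.locallyLipschitz (hf : IsC1Approx f a b) : LocallyLipschitz a := by
  intro x
  obtain ⟨C, hC⟩ := hf.bounded (‖x‖ + 1)
  refine ⟨C.toNNReal, Metric.ball 0 (‖x‖ + 1), Metric.isOpen_ball.mem_nhds (by simp), ?_⟩
  refine lipschitzOnWith_of_eventually_eq (l := atTop) (f := f) (fun n => ?_) fun y _ =>
    (hf.eventually_eq y).mono fun n hn => hn.1
  refine (convex_ball 0 _).lipschitzOnWith_of_nnnorm_deriv_le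
    (fun y _ => (hf.contDiff n).differentiable one_ne_zero y) fun y hy => ?_
  exact NNReal.le_toNNReal_of_coe_le (hC n y (mem_ball_zero_iff.1 hy).le).2

theorem IsC1Approx.eventually_realization_eq (hf : IsC1Approx f a b) {ℓ : ℕ → ℕ} {L : ℕ}
    (θ : Param ℓ L) (x : EuclideanSpace ℝ (Fin (ℓ 0))) (k : ℕ) :
    ∀ᶠ n in atTop, realization (f n) θ x k = realization a θ x k ∧
      realizationDeriv (f n) (deriv (f n)) θ x k = realizationDeriv a b θ x k := by
  have hneurons : ∀ᶠ n in atTop, ∀ m ∈ Set.Ioo 0 k, ∀ i,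
      f n (realization a θ x m i) = a (realization a θ x m i) ∧
        deriv (f n) (realization a θ x m i) = b (realization a θ x m i) :=
    (eventually_all_finite (Set.finite_Ioo 0 k)).2 fun m _ =>
      eventually_all.2 fun i => hf.eventually_eq _
  filter_upwards [hneurons] with n hn using
    ⟨realization_congr fun m hm i => (hn m hm i).1, realizationDeriv_congr hn⟩

end Approximations

section Risk

/-- Losses `H (u, θ, y)` whose risk with respect to a distribution `μ` of pairs `(x, y)` can be
differentiated under the integral sign: the inputs `x` are essentially bounded, the loss is
integrable at `u = 0`, `θ = 0` and, locally uniformly in `(u, θ)`, its partial gradients have a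
`μ`-integrable majorant. -/
structure IsRegularLoss {X E F G : Type*} [NormedAddCommGroup X] [MeasurableSpace X]
    [NormedAddCommGroup E] [InnerProductSpace ℝ E] [CompleteSpace E]
    [NormedAddCommGroup F] [InnerProductSpace ℝ F] [CompleteSpace F]
    [NormedAddCommGroup G] [NormedSpace ℝ G] [MeasurableSpace G]
    (μ : Measure (X × G)) (H : E × F × G → ℝ) : Prop where
  contDiff : ContDiff ℝ 1 H
  integrable_zero : Integrable (fun p => H (0, 0, p.2)) μ
  ae_norm_fst_le : ∃ ρ, ∀ᵐ p ∂μ, ‖p.1‖ ≤ ρ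
  gradients_dominated : ∀ r, ∃ B : X × G → ℝ, Integrable B μ ∧ ∀ᵐ p ∂μ, ∀ u θ, ‖u‖ ≤ r → ‖θ‖ ≤ r →
    ‖∇ (fun u' => H (u', θ, p.2)) u‖ + ‖∇ (fun θ' => H (u, θ', p.2)) θ‖ ≤ B p

variable {ℓ : ℕ → ℕ} {L : ℕ}
  {μ : Measure (EuclideanSpace ℝ (Fin (ℓ 0)) × EuclideanSpace ℝ (Fin (ℓ L)))}
  {H : EuclideanSpace ℝ (Fin (ℓ L)) × Param ℓ L × EuclideanSpace ℝ (Fin (ℓ L)) → ℝ}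
  {f : ℕ → ℝ → ℝ} {a b : ℝ → ℝ}

/-- The formal derivative of `H (realization a θ p.1 L, θ, p.2)` with respect to the parameters
`θ`, where `b` takes the place of the derivative of `a`. -/
def lossDeriv (H : EuclideanSpace ℝ (Fin (ℓ L)) × Param ℓ L × EuclideanSpace ℝ (Fin (ℓ L)) → ℝ)
    (a b : ℝ → ℝ) (θ : Param ℓ L)
    (p : EuclideanSpace ℝ (Fin (ℓ 0)) × EuclideanSpace ℝ (Fin (ℓ L))) : Param ℓ L →L[ℝ] ℝ :=
  fderiv ℝ H (realization a θ p.1 L, θ, p.2) ∘L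
    (realizationDeriv a b θ p.1 L).prod ((ContinuousLinearMap.id ℝ (Param ℓ L)).prod 0)

theorem hasFDerivAt_loss (hH : Differentiable ℝ H) {θ : Param ℓ L}
    {p : EuclideanSpace ℝ (Fin (ℓ 0)) × EuclideanSpace ℝ (Fin (ℓ L))}
    (h : ∀ m ∈ Set.Ioo 0 L, ∀ i, HasDerivAt a (b (realization a θ p.1 m i))
      (realization a θ p.1 m i)) :
    HasFDerivAt (fun θ' => H (realization a θ' p.1 L, θ', p.2)) (lossDeriv H a b θ p) θ :=
  (hH _).hasFDerivAt.comp (f := fun θ' => (realization a θ' p.1 L, θ', p.2)) θ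
    ((hasFDerivAt_realization h).prodMk ((hasFDerivAt_id θ).prodMk (hasFDerivAt_const p.2 θ)))

theorem continuous_loss (hH : Continuous H) (ha : Continuous a) :
    Continuous fun q : Param ℓ L × EuclideanSpace ℝ (Fin (ℓ 0)) × EuclideanSpace ℝ (Fin (ℓ L)) =>
      H (realization a q.1 q.2.1 L, q.1, q.2.2) :=
  hH.comp (((continuous_realization ha L).comp (continuous_fst.prodMk continuous_snd.fst)).prodMk
    (continuous_fst.prodMk continuous_snd.snd))

theorem tendsto_lossDeriv {ι : Type*} {l : Filter ι} (hH : ContDiff ℝ 1 H) (ha : Continuous a)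
    {θ : ι → Param ℓ L} {θ₀ : Param ℓ L}
    {p : ι → EuclideanSpace ℝ (Fin (ℓ 0)) × EuclideanSpace ℝ (Fin (ℓ L))}
    {p₀ : EuclideanSpace ℝ (Fin (ℓ 0)) × EuclideanSpace ℝ (Fin (ℓ L))}
    (hθ : Tendsto θ l (𝓝 θ₀)) (hp : Tendsto p l (𝓝 p₀))
    (hb : ∀ m ∈ Set.Ioo 0 L, ∀ i, Tendsto (fun t => b (realization a (θ t) (p t).1 m i)) l
      (𝓝 (b (realization a θ₀ p₀.1 m i)))) :
    Tendsto (fun t => lossDeriv H a b (θ t) (p t)) l (𝓝 (lossDeriv H a b θ₀ p₀)) := by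
  have hx : Tendsto (fun t => (p t).1) l (𝓝 p₀.1) := (continuous_fst.tendsto p₀).comp hp
  have hy : Tendsto (fun t => (p t).2) l (𝓝 p₀.2) := (continuous_snd.tendsto p₀).comp hp
  have hout : Tendsto (fun t => realization a (θ t) (p t).1 L) l (𝓝 (realization a θ₀ p₀.1 L)) :=
    ((continuous_realization ha L).tendsto (θ₀, p₀.1)).comp (hθ.prodMk_nhds hx)
  have hderiv := ((hH.continuous_fderiv one_ne_zero).tendsto (_, θ₀, p₀.2)).comp
    (hout.prodMk_nhds (hθ.prodMk_nhds hy))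
  have hinner := (continuous_clm_prod.tendsto (realizationDeriv a b θ₀ p₀.1 L,
    (ContinuousLinearMap.id ℝ (Param ℓ L)).prod
      (0 : Param ℓ L →L[ℝ] EuclideanSpace ℝ (Fin (ℓ L))))).comp
    ((tendsto_realizationDeriv ha hθ hx hb).prodMk_nhds tendsto_const_nhds)
  exact ((continuous_fst.clm_comp continuous_snd).tendsto (_, _)).comp
    (hderiv.prodMk_nhds hinner)

theorem IsC1Approx.eventually_lossDeriv_eq (hf : IsC1Approx f a b) (θ : Param ℓ L)
    (p : EuclideanSpace ℝ (Fin (ℓ 0)) × EuclideanSpace ℝ (Fin (ℓ L))) :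
    ∀ᶠ n in atTop, lossDeriv H (f n) (deriv (f n)) θ p = lossDeriv H a b θ p := by
  filter_upwards [hf.eventually_realization_eq θ p.1 L] with n ⟨hN, hD⟩
  rw [lossDeriv, lossDeriv, hN, hD]

theorem IsC1Approx.aestronglyMeasurable_lossDeriv (hf : IsC1Approx f a b) (hH : ContDiff ℝ 1 H)
    (θ : Param ℓ L) : AEStronglyMeasurable (lossDeriv H a b θ) μ := by
  have hcont (n : ℕ) : Continuous (lossDeriv H (f n) (deriv (f n)) θ) :=
    continuous_iff_continuousAt.2 fun p =>
      tendsto_lossDeriv hH (hf.contDiff n).continuous tendsto_const_nhds tendsto_id fun m _ i =>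
        ((((hf.contDiff n).continuous_deriv le_rfl).comp <| (PiLp.continuous_apply 2 _ i).comp <|
          continuous_realization (hf.contDiff n).continuous m).tendsto (θ, p.1)).comp
          (tendsto_const_nhds.prodMk_nhds (continuous_fst.tendsto p))
  exact (stronglyMeasurable_of_tendsto atTop (fun n => (hcont n).stronglyMeasurable) <|
    tendsto_pi_nhds.2 fun p => tendsto_const_nhds.congr' <|
      (hf.eventually_lossDeriv_eq θ p).mono fun n hn => hn.symm).aestronglyMeasurable

theorem IsRegularLoss.exists_integrable_norm_lossDeriv_le (hH : IsRegularLoss μ H) {ι : Type*}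
    {f f' : ι → ℝ → ℝ} (hf : ∀ R, ∃ C, ∀ n x, ‖x‖ ≤ R → ‖f n x‖ ≤ C ∧ ‖f' n x‖ ≤ C) (R : ℝ) :
    ∃ B, Integrable B μ ∧ ∀ᵐ p ∂μ, ∀ n θ, ‖θ‖ ≤ R → ‖lossDeriv H (f n) (f' n) θ p‖ ≤ B p := by
  obtain ⟨ρ, hρ⟩ := hH.ae_norm_fst_le
  obtain ⟨K, hK⟩ := exists_norm_realization_le (ℓ := ℓ) (L := L)
    (fun R => (hf R).imp fun C hC n x hx => (hC n x hx).1) (max R ρ) L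
  obtain ⟨K', hK'⟩ := exists_norm_realizationDeriv_le (ℓ := ℓ) (L := L) hf (max R ρ) L
  obtain ⟨B, hB, hgrad⟩ := hH.gradients_dominated (max K R)
  refine ⟨fun p => (1 + K') * B p, hB.const_mul _, ?_⟩
  filter_upwards [hρ, hgrad] with p hp hBp n θ hθ
  have hθ' := le_max_of_le_left (c := ρ) hθ
  have hp' := le_max_of_le_right (b := R) hp
  have hD := hK' n θ p.1 hθ' hp'
  refine (norm_fderiv_comp_prod_le (hH.contDiff.differentiable one_ne_zero _) _).trans ?_
  refine mul_le_mul (by gcongr)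
    (hBp _ θ (le_max_of_le_left (hK n θ p.1 hθ' hp')) (le_max_of_le_right hθ)) (by positivity) ?_
  linarith [(norm_nonneg _).trans hD]

theorem IsC1Approx.exists_integrable_norm_lossDeriv_le (hf : IsC1Approx f a b)
    (hH : IsRegularLoss μ H) (R : ℝ) :
    ∃ B, Integrable B μ ∧ ∀ᵐ p ∂μ, ∀ θ, ‖θ‖ ≤ R → ‖lossDeriv H a b θ p‖ ≤ B p := by
  obtain ⟨B, hB, hle⟩ := hH.exists_integrable_norm_lossDeriv_le hf.bounded R
  refine ⟨B, hB, hle.mono fun p hp θ hθ => ?_⟩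
  obtain ⟨n, hn⟩ := (hf.eventually_lossDeriv_eq θ p).exists
  exact hn ▸ hp n θ hθ

theorem IsC1Approx.exists_integrable_lipschitzOnWith_loss (hf : IsC1Approx f a b)
    (hH : IsRegularLoss μ H) (R : ℝ) :
    ∃ B, Integrable B μ ∧ ∀ᵐ p ∂μ, LipschitzOnWith (Real.nnabs (B p))
      (fun θ => H (realization a θ p.1 L, θ, p.2)) (Metric.closedBall 0 R) := by
  obtain ⟨B, hB, hle⟩ := hH.exists_integrable_norm_lossDeriv_le hf.bounded R
  refine ⟨B, hB, hle.mono fun p hp => ?_⟩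
  refine lipschitzOnWith_of_eventually_eq (l := atTop)
    (f := fun n θ => H (realization (f n) θ p.1 L, θ, p.2)) (fun n => ?_) fun θ _ =>
    (hf.eventually_realization_eq θ p.1 L).mono fun n hn => by rw [hn.1]
  refine (convex_closedBall 0 R).lipschitzOnWith_of_nnnorm_hasFDerivWithin_le (fun θ _ =>
    (hasFDerivAt_loss (hH.contDiff.differentiable one_ne_zero) fun m _ i =>
      ((hf.contDiff n).differentiable one_ne_zero _).hasDerivAt).hasFDerivWithinAt) fun θ hθ => ?_
  exact (hp n θ (mem_closedBall_zero_iff.1 hθ)).trans (le_abs_self _)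

theorem IsC1Approx.integrable_loss (hf : IsC1Approx f a b) (hH : IsRegularLoss μ H) (hL : L ≠ 0)
    (θ : Param ℓ L) : Integrable (fun p => H (realization a θ p.1 L, θ, p.2)) μ := by
  obtain ⟨B, hB, hlip⟩ := hf.exists_integrable_lipschitzOnWith_loss hH ‖θ‖
  have hmeas := ((continuous_loss hH.contDiff.continuous hf.locallyLipschitz.continuous).comp
    (Continuous.prodMk_right θ)).aestronglyMeasurable (μ := μ)
  refine integrable_of_norm_sub_le (f₀ := fun p => H (realization a (0 : Param ℓ L) p.1 L, 0, p.2))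
    hmeas ?_ (hB.norm.mul_const ‖θ‖) <| hlip.mono fun p hp => ?_
  · simpa only [realization_zero_param a _ hL] using hH.integrable_zero
  · simpa using hp.norm_sub_le (x := (0 : Param ℓ L)) (y := θ) (by simp) (by simp)

/-- The generalized gradient of the risk: the integral of the formal derivatives of the loss, as a
vector. -/
def genGradient (μ : Measure (EuclideanSpace ℝ (Fin (ℓ 0)) × EuclideanSpace ℝ (Fin (ℓ L))))
    (H : EuclideanSpace ℝ (Fin (ℓ L)) × Param ℓ L × EuclideanSpace ℝ (Fin (ℓ L)) → ℝ)
    (a b : ℝ → ℝ) (θ : Param ℓ L) : Param ℓ L :=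
  (InnerProductSpace.toDual ℝ (Param ℓ L)).symm (∫ p, lossDeriv H a b θ p ∂μ)

theorem IsC1Approx.hasGradientAt_risk (hf : IsC1Approx f a b) (hH : IsRegularLoss μ H) (hL : L ≠ 0)
    {θ : Param ℓ L}
    (h : ∀ᵐ p ∂μ, ∀ m ∈ Set.Ioo 0 L, ∀ i, HasDerivAt a (b (realization a θ p.1 m i))
      (realization a θ p.1 m i)) :
    HasGradientAt (risk μ H a) (genGradient μ H a b θ) θ := by
  obtain ⟨B, hB, hlip⟩ := hf.exists_integrable_lipschitzOnWith_loss hH (‖θ‖ + 1)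
  rw [hasGradientAt_iff_hasFDerivAt, genGradient, LinearIsometryEquiv.apply_symm_apply]
  exact (hasFDerivAt_integral_of_dominated_loc_of_lip
    (Metric.closedBall_mem_nhds_of_mem (by simp : θ ∈ Metric.ball 0 (‖θ‖ + 1)))
    (Eventually.of_forall fun θ' => (hf.integrable_loss hH hL θ').aestronglyMeasurable)
    (hf.integrable_loss hH hL θ) (hf.aestronglyMeasurable_lossDeriv hH.contDiff θ) hlip hB
    (h.mono fun p hp => hasFDerivAt_loss (hH.contDiff.differentiable one_ne_zero) hp)).2

theorem IsC1Approx.tendsto_gradient_risk (hf : IsC1Approx f a b) (hH : IsRegularLoss μ H)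
    (hL : L ≠ 0) (θ : Param ℓ L) :
    Tendsto (fun n => ∇ (risk μ H (f n)) θ) atTop (𝓝 (genGradient μ H a b θ)) := by
  have hgrad (n : ℕ) : ∇ (risk μ H (f n)) θ = genGradient μ H (f n) (deriv (f n)) θ :=
    ((IsC1Approx.const (hf.contDiff n)).hasGradientAt_risk hH hL <| Eventually.of_forall
      fun p m _ i => ((hf.contDiff n).differentiable one_ne_zero _).hasDerivAt).gradient
  obtain ⟨B, hB, hle⟩ := hH.exists_integrable_norm_lossDeriv_le hf.bounded ‖θ‖
  simp only [hgrad]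
  refine ((InnerProductSpace.toDual ℝ (Param ℓ L)).symm.continuous.tendsto _).comp <|
    tendsto_integral_of_dominated_convergence B (fun n => ?_) hB (fun n => ?_) ?_
  · exact (IsC1Approx.const (hf.contDiff n)).aestronglyMeasurable_lossDeriv hH.contDiff θ
  · exact hle.mono fun p hp => hp n θ le_rfl
  · exact Eventually.of_forall fun p => tendsto_const_nhds.congr' <|
      (hf.eventually_lossDeriv_eq θ p).mono fun n hn => hn.symm

theorem IsC1Approx.tendsto_genGradient (hf : IsC1Approx f a b) (hH : IsRegularLoss μ H)
    {ι : Type*} {l : Filter ι} [l.IsCountablyGenerated] {θ : ι → Param ℓ L} {θ₀ : Param ℓ L}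
    (hθ : Tendsto θ l (𝓝 θ₀))
    (hb : ∀ᵐ p ∂μ, ∀ m ∈ Set.Ioo 0 L, ∀ i, Tendsto (fun t => b (realization a (θ t) p.1 m i)) l
      (𝓝 (b (realization a θ₀ p.1 m i)))) :
    Tendsto (fun t => genGradient μ H a b (θ t)) l (𝓝 (genGradient μ H a b θ₀)) := by
  obtain ⟨B, hB, hle⟩ := hf.exists_integrable_norm_lossDeriv_le hH (‖θ₀‖ + 1)
  have hbound : ∀ᶠ t in l, ‖θ t‖ ≤ ‖θ₀‖ + 1 :=
    hθ.norm.eventually_le_const (lt_add_one _)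
  refine ((InnerProductSpace.toDual ℝ (Param ℓ L)).symm.continuous.tendsto _).comp <|
    tendsto_integral_filter_of_dominated_convergence B (Eventually.of_forall fun t => ?_)
      (hbound.mono fun t ht => ?_) hB ?_
  · exact hf.aestronglyMeasurable_lossDeriv hH.contDiff (θ t)
  · exact hle.mono fun p hp => hp (θ t) ht
  · exact hb.mono fun p hp => tendsto_lossDeriv hH.contDiff hf.locallyLipschitz.continuous hθ
      tendsto_const_nhds hp

end Risk

section Direction

variable {ℓ : ℕ → ℕ} {L : ℕ}

/-- The parameter vector with vanishing weights all of whose biases in layer `k + 1` are `c k`. The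
coordinates of the biases of layer `k + 1` are the last `ℓ (k + 1)` ones of that layer. -/
def biasVector (ℓ : ℕ → ℕ) (L : ℕ) (c : ℕ → ℝ) : Param ℓ L :=
  WithLp.toLp 2 fun m => ∑ k ∈ Finset.range L,
    if numParams ℓ k + ℓ (k + 1) * ℓ k ≤ m ∧ (m : ℕ) < numParams ℓ (k + 1) then c k else 0

theorem coord_biasVector (c : ℕ → ℝ) {k m : ℕ} (hk : k < L)
    (hm : m ∈ Set.Ico (numParams ℓ k) (numParams ℓ (k + 1))) :
    coord (biasVector ℓ L c) m = if numParams ℓ k + ℓ (k + 1) * ℓ k ≤ m then c k else 0 := by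
  rw [coord, dif_pos (hm.2.trans_le (numParams_mono ℓ hk)), biasVector]
  refine (Finset.sum_eq_single k (fun k' _ hne => if_neg fun hk' => ?_)
    fun h => (h (Finset.mem_range.2 hk)).elim).trans (by simp only [hm.2, and_true])
  exact Set.disjoint_left.1 ((numParams_mono ℓ).pairwise_disjoint_on_Ico_succ hne)
    ⟨(Nat.le_add_right _ _).trans hk'.1, hk'.2⟩ hm

theorem weight_biasVector (c : ℕ → ℝ) {k : ℕ} (hk : k < L) (i : Fin (ℓ (k + 1))) (j : Fin (ℓ k)) :
    weight (biasVector ℓ L c) k i j = 0 := by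
  have hweights : (i : ℕ) * ℓ k + j < ℓ (k + 1) * ℓ k := by
    nlinarith [Nat.mul_le_mul_right (ℓ k) (Nat.succ_le_of_lt i.isLt), j.isLt]
  have hlayer := numParams_succ ℓ k
  rw [mul_add] at hlayer
  rw [weight, coord_biasVector c hk ⟨by omega, by omega⟩, if_neg (by omega)]

theorem bias_biasVector (c : ℕ → ℝ) {k : ℕ} (hk : k < L) (i : Fin (ℓ (k + 1))) :
    bias (biasVector ℓ L c) k i = c k := by
  have hlayer := numParams_succ ℓ k
  rw [mul_add] at hlayer
  rw [bias, coord_biasVector c hk ⟨by omega, by omega⟩, if_pos (by omega)]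

theorem weight_add_smul_biasVector (θ : Param ℓ L) (t : ℝ) (c : ℕ → ℝ) {k : ℕ} (hk : k < L)
    (i : Fin (ℓ (k + 1))) (j : Fin (ℓ k)) :
    weight (θ + t • biasVector ℓ L c) k i j = weight θ k i j := by
  have h := weight_biasVector c hk i j
  rw [weight] at h
  rw [weight, coord_add, coord_smul, h, mul_zero, add_zero, weight]

theorem bias_add_smul_biasVector (θ : Param ℓ L) (t : ℝ) (c : ℕ → ℝ) {k : ℕ} (hk : k < L)
    (i : Fin (ℓ (k + 1))) :
    bias (θ + t • biasVector ℓ L c) k i = bias θ k i + t * c k := by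
  have h := bias_biasVector c hk i
  rw [bias] at h
  rw [bias, coord_add, coord_smul, h, bias]

theorem abs_affineLayer_sub_sub_le {θ θ' : Param ℓ L} {k : ℕ} {i : Fin (ℓ (k + 1))} {d ε : ℝ}
    (hw : ∀ j, weight θ' k i j = weight θ k i j) (hb : bias θ' k i = bias θ k i + d)
    {v v' : EuclideanSpace ℝ (Fin (ℓ k))} (hv : ∀ j, |v' j - v j| ≤ ε) :
    |affineLayer θ' k v' i - affineLayer θ k v i - d| ≤ ℓ k * (‖θ‖ * ε) := by
  have hdiff : affineLayer θ' k v' i - affineLayer θ k v i - d =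
      ∑ j, weight θ k i j * (v' j - v j) := by
    simp only [affineLayer, hw, hb, mul_sub, Finset.sum_sub_distrib]
    ring
  have hterm (j : Fin (ℓ k)) : |weight θ k i j * (v' j - v j)| ≤ ‖θ‖ * ε := by
    rw [abs_mul]
    exact mul_le_mul (abs_coord_le _ _) (hv j) (abs_nonneg _) (norm_nonneg _)
  rw [hdiff]
  exact (Finset.abs_sum_le_sum_abs _ _).trans
    ((Finset.sum_le_card_nsmul _ _ _ fun j _ => hterm j).trans_eq (by simp))

theorem abs_realization_sub_sub_le {a : ℝ → ℝ} {C : NNReal} {s : Set ℝ}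
    (ha : LipschitzOnWith C a s) {θ θ' : Param ℓ L} {x : EuclideanSpace ℝ (Fin (ℓ 0))}
    (hθ : ∀ m ∈ Set.Ioo 0 L, ∀ i, realization a θ x m i ∈ s)
    (hθ' : ∀ m ∈ Set.Ioo 0 L, ∀ i, realization a θ' x m i ∈ s) {d : ℕ → ℝ}
    (hw : ∀ k < L, ∀ i j, weight θ' k i j = weight θ k i j)
    (hb : ∀ k < L, ∀ i, bias θ' k i = bias θ k i + d k)
    (hd : ∀ k, 4 * (ℓ (k + 1) * (‖θ‖ * C)) * |d k| ≤ |d (k + 1)|) :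
    ∀ k < L, ∀ i, |realization a θ' x (k + 1) i - realization a θ x (k + 1) i - d k| ≤ |d k| / 2
  | 0, hk, i => by
    refine (abs_affineLayer_sub_sub_le (ε := 0) (hw 0 hk i) (hb 0 hk i) (by simp)).trans ?_
    simp only [mul_zero]
    positivity
  | k + 1, hk, i => by
    have hstep (j : Fin (ℓ (k + 1))) :
        |realization a θ' x (k + 1) j - realization a θ x (k + 1) j| ≤ 3 / 2 * |d k| := by
      have hsplit := abs_add_le (realization a θ' x (k + 1) j - realization a θ x (k + 1) j - d k)
        (d k)
      rw [sub_add_cancel] at hsplit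
      linarith [abs_realization_sub_sub_le ha hθ hθ' hw hb hd k (by omega) j]
    have hact (j : Fin (ℓ (k + 1))) :
        |a (realization a θ' x (k + 1) j) - a (realization a θ x (k + 1) j)| ≤
          C * (3 / 2 * |d k|) :=
      (ha.norm_sub_le (hθ' _ ⟨k.succ_pos, hk⟩ j) (hθ _ ⟨k.succ_pos, hk⟩ j)).trans
        (mul_le_mul_of_nonneg_left (hstep j) C.coe_nonneg)
    refine (abs_affineLayer_sub_sub_le (hw _ hk i) (hb _ hk i) hact).trans ?_
    have hpos : 0 ≤ ℓ (k + 1) * (‖θ‖ * C) * |d k| := by positivity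
    linarith [hd k]

theorem exists_lipschitzOnWith_preactivations {a : ℝ → ℝ} (ha : LocallyLipschitz a)
    (ℓ : ℕ → ℕ) (L : ℕ) (R ρ : ℝ) :
    ∃ C s, LipschitzOnWith C a s ∧ ∀ (θ : Param ℓ L) x, ‖θ‖ ≤ R → ‖x‖ ≤ ρ →
      ∀ m ∈ Set.Ioo 0 L, ∀ i, realization a θ x m i ∈ s := by
  set K : Set (Param ℓ L × EuclideanSpace ℝ (Fin (ℓ 0))) :=
    Metric.closedBall 0 R ×ˢ Metric.closedBall 0 ρ
  have hcompact : IsCompact (⋃ m ∈ Set.Ioo 0 L, ⋃ i : Fin (ℓ m),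
      (fun q => realization a q.1 q.2 m i) '' K) :=
    (Set.finite_Ioo 0 L).isCompact_biUnion fun m _ => isCompact_iUnion fun i =>
      ((isCompact_closedBall _ _).prod (isCompact_closedBall _ _)).image
        ((PiLp.continuous_apply 2 _ i).comp (continuous_realization ha.continuous m))
  obtain ⟨C, hC⟩ := ha.locallyLipschitzOn.exists_lipschitzOnWith_of_compact hcompact
  refine ⟨C, _, hC, fun θ x hθ hx m hm i => Set.mem_biUnion hm (Set.mem_iUnion.2 ⟨i, ?_⟩)⟩
  exact ⟨(θ, x), ⟨mem_closedBall_zero_iff.2 hθ, mem_closedBall_zero_iff.2 hx⟩, rfl⟩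

theorem mul_pos_of_abs_sub_le_half {y d : ℝ} (hd : d ≠ 0) (h : |y - d| ≤ |d| / 2) : 0 < d * y := by
  rcases hd.lt_or_gt with hneg | hpos
  · rw [abs_of_neg hneg] at h
    exact mul_pos_of_neg_of_neg hneg (by linarith [(abs_le.1 h).2])
  · rw [abs_of_pos hpos] at h
    exact mul_pos hpos (by linarith [(abs_le.1 h).1])

theorem exists_pos_mul_le_succ (A : ℕ → ℝ) :
    ∃ c : ℕ → ℝ, (∀ k, 0 < c k) ∧ ∀ k, A k * c k ≤ c (k + 1) := by
  have hpos (k : ℕ) : 0 < ∏ i ∈ Finset.range k, (1 + |A i|) :=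
    Finset.prod_pos fun i _ => by positivity
  refine ⟨fun k => ∏ i ∈ Finset.range k, (1 + |A i|), hpos, fun k => ?_⟩
  rw [mul_comm]
  exact (mul_le_mul_of_nonneg_left (by linarith [le_abs_self (A k)]) (hpos k).le).trans_eq
    (Finset.prod_range_succ _ k).symm

theorem exists_norm_add_smul_le {E : Type*} [SeminormedAddCommGroup E] [NormedSpace ℝ E] (x v : E)
    {R : ℝ} (hR : ‖x‖ < R) : ∃ δ > 0, ∀ t ∈ Set.Icc (0 : ℝ) δ, ‖x + t • v‖ ≤ R := by
  have hcont : Continuous fun t : ℝ => ‖x + t • v‖ := by fun_prop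
  obtain ⟨δ, hδ, hball⟩ := Metric.nhds_basis_closedBall.eventually_iff.1
    ((hcont.tendsto 0).eventually_le_const (u := R) (by simpa using hR))
  refine ⟨δ, hδ, fun t ht => hball ?_⟩
  rw [Real.closedBall_eq_Icc]
  exact ⟨by linarith [ht.1], by linarith [ht.2]⟩

-- Moving along `v` shifts the biases of layer `k + 1` at speed `z * c k`. As `c` grows fast, this
-- outweighs the motion which the layer inherits from the layers below it.
theorem exists_direction_strictMonoOn_preactivations {a : ℝ → ℝ} (ha : LocallyLipschitz a)
    (θ : Param ℓ L) (ρ : ℝ) {z : ℝ} (hz : z ≠ 0) :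
    ∃ v : Param ℓ L, ∃ δ > 0, ∀ x : EuclideanSpace ℝ (Fin (ℓ 0)), ‖x‖ ≤ ρ →
      ∀ m ∈ Set.Ioo 0 L, ∀ i,
        StrictMonoOn (fun t : ℝ => z * realization a (θ + t • v) x m i) (Set.Icc 0 δ) := by
  obtain ⟨C, s, hC, hs⟩ := exists_lipschitzOnWith_preactivations ha ℓ L (‖θ‖ + 1) ρ
  obtain ⟨c, hc, hgrowth⟩ := exists_pos_mul_le_succ fun k => 4 * (ℓ (k + 1) * ((‖θ‖ + 1) * C))
  set v := biasVector ℓ L fun k => z * c k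
  obtain ⟨δ, hδ, hnorm⟩ := exists_norm_add_smul_le θ v (lt_add_one ‖θ‖)
  refine ⟨v, δ, hδ, fun x hx m hm i t ht t' ht' htt' => ?_⟩
  obtain ⟨k, rfl⟩ := Nat.exists_eq_succ_of_ne_zero hm.1.ne'
  have htt := sub_pos.2 htt'
  have hfast (j : ℕ) : 4 * (ℓ (j + 1) * (‖θ + t • v‖ * C)) * |(t' - t) * (z * c j)| ≤
      |(t' - t) * (z * c (j + 1))| := by
    simp only [abs_mul, abs_of_pos htt, abs_of_pos (hc _)]
    calc 4 * (ℓ (j + 1) * (‖θ + t • v‖ * C)) * ((t' - t) * (|z| * c j))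
        ≤ 4 * (ℓ (j + 1) * ((‖θ‖ + 1) * C)) * ((t' - t) * (|z| * c j)) := by
          have := (hc j).le
          gcongr
          exact hnorm t ht
      _ = (t' - t) * (|z| * (4 * (ℓ (j + 1) * ((‖θ‖ + 1) * C)) * c j)) := by ring
      _ ≤ (t' - t) * (|z| * c (j + 1)) := by
          gcongr
          exact hgrowth j
  have hshift := abs_realization_sub_sub_le hC (hs _ x (hnorm t ht) hx)
    (hs _ x (hnorm t' ht') hx)
    (fun k hk i j => by simp only [v, weight_add_smul_biasVector _ _ _ hk])
    (fun k hk i => by simp only [v, bias_add_smul_biasVector _ _ _ hk]; ring)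
    hfast k (k.lt_succ_self.trans hm.2) i
  have hpos := mul_pos_of_abs_sub_le_half
    (mul_ne_zero htt.ne' (mul_ne_zero hz (hc k).ne')) hshift
  refine sub_pos.1 ((mul_pos_iff_of_pos_left (mul_pos htt (hc k))).1 (hpos.trans_eq ?_))
  ring

end Direction

section LimitingGradient

variable {ℓ : ℕ → ℕ} {L : ℕ}
  {μ : Measure (EuclideanSpace ℝ (Fin (ℓ 0)) × EuclideanSpace ℝ (Fin (ℓ L)))}
  {H : EuclideanSpace ℝ (Fin (ℓ L)) × Param ℓ L × EuclideanSpace ℝ (Fin (ℓ L)) → ℝ}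
  {f : ℕ → ℝ → ℝ} {a b : ℝ → ℝ}

theorem frequently_ae_preactivations_notMem [SFinite μ] (ha : Continuous a) {S : Set ℝ}
    (hS : S.Countable) {θ v : Param ℓ L} {δ z : ℝ} (hδ : 0 < δ)
    (hmono : ∀ᵐ p ∂μ, ∀ m ∈ Set.Ioo 0 L, ∀ i,
      StrictMonoOn (fun t : ℝ => z * realization a (θ + t • v) p.1 m i) (Set.Icc 0 δ)) :
    ∃ᶠ t : ℝ in 𝓝[>] 0, ∀ᵐ p ∂μ, ∀ m ∈ Set.Ioo 0 L, ∀ i,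
      realization a (θ + t • v) p.1 m i ∉ S := by
  have hcount : (⋃ m ∈ Set.Ioo 0 L, ⋃ i : Fin (ℓ m), {t ∈ Set.Icc 0 δ |
      ¬ ∀ᵐ p ∂μ, realization a (θ + t • v) p.1 m i ∉ S}).Countable := by
    refine (Set.to_countable _).biUnion fun m hm => Set.countable_iUnion fun i =>
      countable_setOf_not_ae_notMem (fun t => ?_) (hmono.mono fun p hp => ?_) hS
    · exact ((PiLp.continuous_apply 2 _ i).comp <| (continuous_realization ha m).comp <|
        continuous_const.prodMk continuous_fst).measurable
    · exact fun t ht t' ht' htt' => (hp m hm i).injOn ht ht' (congrArg (z * ·) htt')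
  refine ((frequently_nhdsGT_notMem_of_countable hcount 0).and_eventually
    (Ioc_mem_nhdsGT hδ)).mono fun t ⟨hgood, ht⟩ => ?_
  refine (ae_ball_iff (Set.to_countable _)).2 fun m hm => ae_all_iff.2 fun i => ?_
  by_contra hbad
  exact hgood (Set.mem_biUnion hm (Set.mem_iUnion.2 ⟨i, ⟨ht.1.le, ht.2⟩, hbad⟩))

theorem tendsto_preactivation_of_strictMonoOn (ha : Continuous a) {z : ℝ} (hz : z ≠ 0)
    (hb : ∀ s, Tendsto (fun h => b (s + z * h)) (𝓝[>] 0) (𝓝 (b s))) {θ v : Param ℓ L} {δ : ℝ}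
    (hδ : 0 < δ) {x : EuclideanSpace ℝ (Fin (ℓ 0))} {m : ℕ} {i : Fin (ℓ m)}
    (hmono : StrictMonoOn (fun t : ℝ => z * realization a (θ + t • v) x m i) (Set.Icc 0 δ)) :
    Tendsto (fun t : ℝ => b (realization a (θ + t • v) x m i)) (𝓝[>] 0)
      (𝓝 (b (realization a θ x m i))) := by
  have hcont : Continuous fun t : ℝ => realization a (θ + t • v) x m i :=
    (PiLp.continuous_apply 2 _ i).comp <| (continuous_realization ha m).comp
      (f := fun t : ℝ => (θ + t • v, x)) (by fun_prop)
  refine tendsto_comp_of_tendsto_oneSided hz (hb _) ?_ ?_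
  · simpa using (hcont.tendsto 0).mono_left nhdsWithin_le_nhds
  · filter_upwards [Ioc_mem_nhdsGT hδ] with t ht
    simpa using hmono ⟨le_rfl, hδ.le⟩ ⟨ht.1.le, ht.2⟩ ht.1

theorem IsC1Approx.genGradient_mem_limitingSubdiff [SFinite μ] (hf : IsC1Approx f a b)
    (hH : IsRegularLoss μ H) (hL : L ≠ 0) {S : Set ℝ} (hS : S.Countable)
    (hab : ∀ x ∉ S, HasDerivAt a (b x) x) {z : ℝ} (hz : z ≠ 0)
    (hb : ∀ x, Tendsto (fun h => b (x + z * h)) (𝓝[>] 0) (𝓝 (b x))) (θ : Param ℓ L) :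
    genGradient μ H a b θ ∈ limitingSubdiff (risk μ H a) θ := by
  have ha := hf.locallyLipschitz
  obtain ⟨ρ, hρ⟩ := hH.ae_norm_fst_le
  obtain ⟨v, δ, hδ, hmono⟩ := exists_direction_strictMonoOn_preactivations ha θ ρ hz
  have hcurve : Tendsto (fun t : ℝ => θ + t • v) (𝓝[>] 0) (𝓝 θ) := by
    have hcont : Continuous fun t : ℝ => θ + t • v := by fun_prop
    simpa using (hcont.tendsto 0).mono_left nhdsWithin_le_nhds
  have hlim : Tendsto (fun t : ℝ => genGradient μ H a b (θ + t • v)) (𝓝[>] 0)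
      (𝓝 (genGradient μ H a b θ)) :=
    hf.tendsto_genGradient hH hcurve <| hρ.mono fun p hp m hm i =>
      tendsto_preactivation_of_strictMonoOn ha.continuous hz hb hδ (hmono p.1 hp m hm i)
  have hdiff : ∃ᶠ t : ℝ in 𝓝[>] 0,
      HasGradientAt (risk μ H a) (genGradient μ H a b (θ + t • v)) (θ + t • v) :=
    (frequently_ae_preactivations_notMem ha.continuous hS hδ
      (hρ.mono fun p hp => hmono p.1 hp)).mono fun t ht =>
      hf.hasGradientAt_risk hH hL <| ht.mono fun p hp m hm i => hab _ (hp m hm i)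
  exact mem_limitingSubdiff_of_frequently hcurve hlim
    (hdiff.mono fun t ht => mem_frechetSubdiff_of_hasGradientAt ht)

end LimitingGradient

section GeneralizedDerivatives

theorem hasDerivAt_genDeriv {S : Finset ℝ} (gS : ↥(S : Set ℝ) → ℝ) {f : ℝ → ℝ}
    (hf : ContDiffOn ℝ 1 f (S : Set ℝ)ᶜ) {x : ℝ} (hx : x ∉ S) :
    HasDerivAt f (genDeriv S gS f x) x := by
  rw [genDeriv, dif_neg (by simpa using hx)]
  exact ((hf.contDiffAt (S.isClosed.isOpen_compl.mem_nhds (by simpa using hx))).differentiableAt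
    one_ne_zero).hasDerivAt

theorem continuousAt_genDeriv {S : Finset ℝ} (gS : ↥(S : Set ℝ) → ℝ) {f : ℝ → ℝ}
    (hf : ContDiffOn ℝ 1 f (S : Set ℝ)ᶜ) {x : ℝ} (hx : x ∉ S) :
    ContinuousAt (genDeriv S gS f) x := by
  have hopen : IsOpen (S : Set ℝ)ᶜ := S.isClosed.isOpen_compl
  have hmem : (S : Set ℝ)ᶜ ∈ 𝓝 x := hopen.mem_nhds (by simpa using hx)
  refine ((hf.continuousOn_deriv_of_isOpen hopen le_rfl).continuousAt hmem).congr ?_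
  filter_upwards [hmem] with y hy
  rw [genDeriv, dif_neg hy]

theorem tendsto_of_oneSidedJump_eq_zero {S : Finset ℝ} {f : ℝ → ℝ} {z : ℝ}
    (h : oneSidedJump S f z = 0) {s : ℝ} (hs : s ∈ S) :
    Tendsto (fun t => f (s + z * t)) (𝓝[>] 0) (𝓝 (f s)) := by
  have hlimsup := Finset.sum_eq_zero_iff.1 h s hs
  refine Metric.tendsto_nhds.2 fun ε hε => ?_
  filter_upwards [eventually_lt_of_limsup_lt (hlimsup.trans_lt (ENNReal.ofReal_pos.2 hε))] with t ht
  exact (ENNReal.ofReal_lt_ofReal_iff hε).1 ht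

theorem exists_tendsto_genDeriv_oneSided {S : Finset ℝ} {gS : ↥(S : Set ℝ) → ℝ} {f : ℝ → ℝ}
    (hf : ContDiffOn ℝ 1 f (S : Set ℝ)ᶜ)
    (hside : min (oneSidedJump S (genDeriv S gS f) (-1)) (oneSidedJump S (genDeriv S gS f) 1) = 0) :
    ∃ z : ℝ, z ≠ 0 ∧ ∀ x, Tendsto (fun h => genDeriv S gS f (x + z * h)) (𝓝[>] 0)
      (𝓝 (genDeriv S gS f x)) := by
  obtain ⟨z, hz, hjump⟩ : ∃ z : ℝ, z ≠ 0 ∧ oneSidedJump S (genDeriv S gS f) z = 0 := by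
    rcases min_choice (oneSidedJump S (genDeriv S gS f) (-1))
      (oneSidedJump S (genDeriv S gS f) 1) with hmin | hmin
    · exact ⟨-1, by norm_num, hmin.symm.trans hside⟩
    · exact ⟨1, one_ne_zero, hmin.symm.trans hside⟩
  refine ⟨z, hz, fun x => ?_⟩
  by_cases hx : x ∈ S
  · exact tendsto_of_oneSidedJump_eq_zero hjump hx
  · have hline : Tendsto (fun h : ℝ => x + z * h) (𝓝[>] 0) (𝓝 x) := by
      have hcont : Continuous fun h : ℝ => x + z * h := by fun_prop
      simpa using (hcont.tendsto 0).mono_left nhdsWithin_le_nhds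
    exact (continuousAt_genDeriv gS hf hx).tendsto.comp hline

theorem isC1Approx_of_tsum_eq_zero {b : ℝ → ℝ} {g : ℕ → ℝ → ℝ}
    (hg : ∀ n, 1 ≤ n → ContDiff ℝ 1 (g n))
    (hconv : ∀ x : ℝ, ∃ m : ℕ, 1 ≤ m ∧
      ∑' n : ℕ, ENNReal.ofReal (|g (m + n) x - g 0 x| + |deriv (g (m + n)) x - b x|) = 0)
    (hloc : ∀ m : ℕ, ∃ C : ℝ, ∀ n, 1 ≤ n → ∀ x ∈ Set.Icc (-(m : ℝ)) m,
      |g n x| + |deriv (g n) x| ≤ C) :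
    IsC1Approx (fun n => g (n + 1)) (g 0) b where
  contDiff n := hg (n + 1) n.succ_pos
  eventually_eq x := by
    obtain ⟨m, -, hsum⟩ := hconv x
    filter_upwards [eventually_ge_atTop m] with n hn
    have hterm := ENNReal.ofReal_eq_zero.1 (ENNReal.tsum_eq_zero.1 hsum (n + 1 - m))
    rw [Nat.add_sub_cancel' (by omega)] at hterm
    obtain ⟨hval, hderiv⟩ := (add_eq_zero_iff_of_nonneg (abs_nonneg _) (abs_nonneg _)).1
      (hterm.antisymm (by positivity))
    exact ⟨sub_eq_zero.1 (abs_eq_zero.1 hval), sub_eq_zero.1 (abs_eq_zero.1 hderiv)⟩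
  bounded R := by
    obtain ⟨C, hC⟩ := hloc ⌈R⌉₊
    refine ⟨C, fun n x hx => ?_⟩
    have hsum := hC (n + 1) n.succ_pos x (abs_le.1 (hx.trans (Nat.le_ceil R)))
    exact ⟨(le_add_of_nonneg_right (abs_nonneg _)).trans hsum,
      (le_add_of_nonneg_left (abs_nonneg _)).trans hsum⟩

end GeneralizedDerivatives

theorem isRegularLoss_of_gradients_le {m k n : ℕ}
    {μ : Measure (EuclideanSpace ℝ (Fin m) × EuclideanSpace ℝ (Fin n))} [IsFiniteMeasure μ]
    {H : EuclideanSpace ℝ (Fin n) × EuclideanSpace ℝ (Fin k) × EuclideanSpace ℝ (Fin n) → ℝ}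
    (hH : ContDiff ℝ 1 H) (hint : Integrable (fun p => H (0, 0, p.2)) μ)
    (hbdd : Bornology.IsBounded {x | ∃ y, (x, y) ∈ μ.support})
    (hgrow : ∀ r : ℝ, 0 < r → ∃ C : ℝ,
      ∀ (x : EuclideanSpace ℝ (Fin m)) (y u : EuclideanSpace ℝ (Fin n))
        (θ : EuclideanSpace ℝ (Fin k)),
        (x, y) ∈ μ.support → (∀ i, |x i| ≤ r) → (∀ i, |u i| ≤ r) → (∀ i, |θ i| ≤ r) →
        (‖∇ (fun u' => H (u', θ, y)) u‖ + ‖∇ (fun θ' => H (u, θ', y)) θ‖)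
          / (1 + |H (0, 0, y)|) ≤ C) : IsRegularLoss μ H := by
  obtain ⟨ρ, hρ⟩ := hbdd.exists_norm_le
  refine ⟨hH, hint, ⟨ρ, ?_⟩, fun r => ?_⟩
  · filter_upwards [Measure.support_mem_ae] with p hp using hρ p.1 ⟨p.2, hp⟩
  obtain ⟨C, hC⟩ := hgrow (max 1 (max ρ r)) (zero_lt_one.trans_le (le_max_left _ _))
  refine ⟨fun p => C * (1 + |H (0, 0, p.2)|), ((integrable_const 1).add hint.abs).const_mul C, ?_⟩
  filter_upwards [Measure.support_mem_ae] with p hp u θ hu hθ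
  have hcoord {d : ℕ} {w : EuclideanSpace ℝ (Fin d)} (hw : ‖w‖ ≤ max ρ r) (i : Fin d) :
      |w i| ≤ max 1 (max ρ r) :=
    ((PiLp.norm_apply_le w i).trans hw).trans (le_max_right _ _)
  exact (div_le_iff₀ (by positivity)).1 <| hC p.1 p.2 u θ hp
    (hcoord (le_max_of_le_left (hρ p.1 ⟨p.2, hp⟩))) (hcoord (le_max_of_le_right hu))
    (hcoord (le_max_of_le_right hθ))

end DeepANN

end

open DeepANN

theorem mainTheorem3_general {ℓ : ℕ → ℕ} {L : ℕ} (hL : L ≠ 0) {S : Set ℝ} (hS : S.Countable)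
    {f : ℕ → ℝ → ℝ} {a b : ℝ → ℝ} (hf : IsC1Approx f a b) (hab : ∀ x ∉ S, HasDerivAt a (b x) x)
    {z : ℝ} (hz : z ≠ 0) (hb : ∀ x, Tendsto (fun h => b (x + z * h)) (𝓝[>] 0) (𝓝 (b x)))
    {μ : Measure (EuclideanSpace ℝ (Fin (ℓ 0)) × EuclideanSpace ℝ (Fin (ℓ L)))} [SFinite μ]
    {H : EuclideanSpace ℝ (Fin (ℓ L)) × Param ℓ L × EuclideanSpace ℝ (Fin (ℓ L)) → ℝ}
    (hH : IsRegularLoss μ H) (θ : Param ℓ L) :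
    ∃ w ∈ limitingSubdiff (risk μ H a) θ,
      Tendsto (fun n => ∇ (risk μ H (f n)) θ) atTop (𝓝 w) :=
  ⟨genGradient μ H a b θ, hf.genGradient_mem_limitingSubdiff hH hL hS hab hz hb θ,
    hf.tendsto_gradient_risk hH hL θ⟩

theorem mainTheorem3
    (ℓ : ℕ → ℕ) (hℓ : ∀ k, 0 < ℓ k) (L : ℕ) (hL : 0 < L)
    -- the kinks `S`, the values of the generalized derivative on them, the activation function
    -- `g 0` and its approximations `g n`, `n ≥ 1`
    (S : Finset ℝ) (gS : ↥(S : Set ℝ) → ℝ) (g : ℕ → ℝ → ℝ)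
    (hg : ∀ n, 1 ≤ n → ContDiff ℝ 1 (g n))
    (hg0 : ContDiffOn ℝ 1 (g 0) (S : Set ℝ)ᶜ)
    (hconv : ∀ x : ℝ, ∃ m : ℕ, 1 ≤ m ∧
      ∑' n : ℕ, ENNReal.ofReal (|g (m + n) x - g 0 x|
        + |deriv (g (m + n)) x - DeepANN.genDeriv S gS (g 0) x|) = 0)
    (μ : Measure (EuclideanSpace ℝ (Fin (ℓ 0)) × EuclideanSpace ℝ (Fin (ℓ L))))
    [IsFiniteMeasure μ]
    (H : EuclideanSpace ℝ (Fin (ℓ L)) × DeepANN.Param ℓ L × EuclideanSpace ℝ (Fin (ℓ L)) → ℝ)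
    (hH : ContDiff ℝ 1 H)
    (hint : ∀ n (θ : DeepANN.Param ℓ L),
      Integrable (fun p => H (DeepANN.realization (g n) θ p.1 L, θ, p.2)) μ)
    (hbdd : Bornology.IsBounded {x | ∃ y, (x, y) ∈ μ.support})
    (hgrow : ∀ r : ℝ, 0 < r → ∀ (U : EuclideanSpace ℝ (Fin (ℓ L))) (Θ : DeepANN.Param ℓ L),
      (∀ i, |U i| ≤ r) → (∀ i, |Θ i| ≤ r) → ∃ C : ℝ,
        ∀ (x : EuclideanSpace ℝ (Fin (ℓ 0))) (y u : EuclideanSpace ℝ (Fin (ℓ L)))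
          (θ : DeepANN.Param ℓ L),
          (x, y) ∈ μ.support → (∀ i, |x i| ≤ r) → (∀ i, |u i| ≤ r) → (∀ i, |θ i| ≤ r) →
          (‖∇ (fun u' => H (u', θ, y)) u‖ + ‖∇ (fun θ' => H (u, θ', y)) θ‖)
            / (1 + |H (U, Θ, y)|) ≤ C)
    (G : DeepANN.Param ℓ L → DeepANN.Param ℓ L)
    (hG : ∀ θ v, Tendsto (fun n => ∇ (DeepANN.risk μ H (g n)) θ) atTop (𝓝 v) → G θ = v)
    -- local uniform boundedness of the approximations and their derivatives
    (hloc : ∀ m : ℕ, ∃ C : ℝ, ∀ n, 1 ≤ n → ∀ x ∈ Set.Icc (-(m : ℝ)) m,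
      |g n x| + |deriv (g n) x| ≤ C)
    -- one-sided continuity of the generalized derivative at all kinks from a common side
    (hside : min (DeepANN.oneSidedJump S (DeepANN.genDeriv S gS (g 0)) (-1))
      (DeepANN.oneSidedJump S (DeepANN.genDeriv S gS (g 0)) 1) = 0)
    (θ : DeepANN.Param ℓ L) :
    G θ ∈ DeepANN.limitingSubdiff (DeepANN.risk μ H (g 0)) θ := by
  have hf := isC1Approx_of_tsum_eq_zero hg hconv hloc
  obtain ⟨z, hz, hb⟩ := exists_tendsto_genDeriv_oneSided hg0 hside
  have hzero : Integrable (fun p => H (0, 0, p.2)) μ := by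
    simpa only [realization_zero_param _ _ hL.ne'] using hint 0 0
  have hloss : IsRegularLoss μ H := isRegularLoss_of_gradients_le hH hzero hbdd fun r hr =>
    hgrow r hr 0 0 (by simp [hr.le]) (by simp [hr.le])
  obtain ⟨w, hw, hlim⟩ := mainTheorem3_general hL.ne' S.countable_toSet hf
    (fun x hx => hasDerivAt_genDeriv gS hg0 hx) hz hb hloss θ
  rwa [hG θ w ((tendsto_add_atTop_iff_nat 1).1 hlim)]
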